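/- \textbf{Theorem 1.2.} A \emph{continuum} is a nonempty compact connected metric space; it is \emph{nondegenerate} if it has more than one point, and it is \emph{Suslinian} if every family of pairwise disjoint nondegenerate subcontinua (nondegenerate compact connected subsets) of it is countable. A finitely generated group $G$ has \emph{subexponential growth} if, for a finite generating set $S$, $$\lim_{k\to\infty}\sqrt[k]{\beta(G,S;k)}\le 1,\qquad \beta(G,S;k)=\#\{g\in G:\ |g|\le k\},$$ where $|g|$ is the word length of $g$ with respect to $S$. A continuous action of a discrete group $G$ on a compact metric space $(X,d)$, that is, a group homomorphism $G\to\mathrm{Homeo}(X)$, is \emph{expansive} if there is a constant $c>0$ such that $\sup_{g\in G}d(gx,gy)>c$ for any two distinct points $x,y\in X$. Let $G$ be a finitely generated group of subexponential growth and let $X$ be a nondegenerate Suslinian continuum. Then no continuous action of $G$ on $X$ is expansive. -/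

import Mathlib

/-- A subset `A` of a topological space `X` is a nondegenerate subcontinuum if it is a compact
connected (hence nonempty) set with more than one point. -/
def IsNondegenerateSubcontinuum {X : Type*} [TopologicalSpace X] (A : Set X) : Prop :=
  IsCompact A ∧ IsConnected A ∧ A.Nontrivial

/-- `X` is Suslinian if every family of pairwise disjoint nondegenerate subcontinua of `X`
is countable. -/
def IsSuslinian (X : Type*) [TopologicalSpace X] : Prop :=
  ∀ F : Set (Set X), (∀ A ∈ F, IsNondegenerateSubcontinuum A) →
    F.Pairwise Disjoint → F.Countable

/-- The word length of `g` with respect to `S`: the least length of a list of elements of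
`S ∪ S⁻¹` whose product is `g` (for `g` in the subgroup generated by `S`). -/
noncomputable def wordLength {G : Type*} [Group G] (S : Set G) (g : G) : ℕ :=
  sInf {n : ℕ | ∃ l : List G, l.length = n ∧ (∀ x ∈ l, x ∈ S ∨ x⁻¹ ∈ S) ∧ l.prod = g}

/-- The growth function of `G` with respect to the finite generating set `S`: the number of
elements of word length at most `k`. -/
noncomputable def growthFunction {G : Type*} [Group G] (S : Set G) (k : ℕ) : ℕ :=
  {g : G | wordLength S g ≤ k}.ncard

/-- `G` has a finite generating set `S` for which the `k`-th roots of the growth function converge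
to a limit that is at most `1`. -/
def HasSubexponentialGrowth (G : Type*) [Group G] : Prop :=
  ∃ S : Set G, S.Finite ∧ Subgroup.closure S = ⊤ ∧
    ∃ L : ℝ, L ≤ 1 ∧
      Filter.Tendsto (fun k : ℕ => (growthFunction S k : ℝ) ^ (1 / (k : ℝ))) Filter.atTop (nhds L)

/-- A continuous action `φ : G → Homeo(X)` on a compact metric space is expansive if there is
`c > 0` such that `sup_{g ∈ G} d(gx, gy) > c` for any two distinct points `x`, `y`. The supremum is
over a bounded set of reals because `X` is compact. -/
def IsExpansiveAction {G X : Type*} [Group G] [MetricSpace X] [CompactSpace X]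
    (φ : G →* (X ≃ₜ X)) : Prop :=
  ∃ c : ℝ, 0 < c ∧ ∀ x y : X, x ≠ y → c < ⨆ g : G, dist (φ g x) (φ g y)

/-! An expansive action on `X` would produce an uncountable family of pairwise disjoint
nondegenerate subcontinua.

Let `c` be an expansivity constant and call a continuum *large* if its diameter is at least `c / 4`.
By compactness and boundary bumping there is a finite `F ⊆ G` such that every large continuum `A`
has an image `g A`, `g ∈ F`, which contains two large continua lying in two disjoint balls from a
fixed finite collection (`exists_isSplitting`). Iterating this `r` times gives `2 ^ r` disjoint
subcontinua of `A`, each of which becomes large under a product of `r` elements of `F`. These group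
elements depend on the branch, and the point is to find many branches along which they agree.

To this end one considers lists of *splits* `(t, h, z, z')` with `h ∈ F ^ t`: such a list is
shattered by `A` if, applying the elements `h` in turn, one can choose at every step freely between
the balls about `z` and `z'` and still find a large continuum. As in the Sauer–Shelah lemma, at
least `2 ^ r` lists of total gap `∑ t ≤ r` are shattered (`IsSplitting.exists_finset_shatters`).
Give a split the weight `y * (3 / 4) ^ t`. Since `|F ^ t|` grows subexponentially, `y` can be chosen
such that all lists together have weight at most `2`, and so the shattered lists cannot all be
short: some have length proportional to `r` (`IsSplitting.exists_long_shatters`).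

A list of positive density contains positions from which the gaps, read backwards, are bounded by a
sequence `L 0, L 1, …` that does not depend on the list (`exists_backward_window`). The `i`-th split
before such a position therefore ranges over a finite set, and a compactness argument gives an
infinite sequence of splits, read backwards in time, for which every `σ : ℕ → Bool` is realised by a
large continuum `D σ` (`IsSplitting.exists_coding`). Looking backwards is essential: the continua are
large at the last time only, and it is this last time that survives in the limit. Two distinct
sequences differ at some digit, which puts the two continua into translates of disjoint balls by the
same group element. So the `D σ` are pairwise disjoint, which is impossible in a Suslinian space.
-/

open Set Filter Topology Metric
open scoped Pointwise

/-! ### Continua of large diameter -/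

/-- A subcontinuum of diameter at least `δ` (the diameter is attained, by compactness). -/
def IsLargeContinuum {X : Type*} [MetricSpace X] (δ : ℝ) (A : Set X) : Prop :=
  IsCompact A ∧ IsConnected A ∧ ∃ x ∈ A, ∃ y ∈ A, δ ≤ dist x y

/-- Boundary bumping: in a connected compact set that leaves the closed ball of radius `ρ` about
`x`, the component of `x` inside that ball reaches the bounding sphere. -/
theorem exists_isLargeContinuum_subset_closedBall {X : Type*} [MetricSpace X] {A : Set X}
    (hA : IsCompact A) (hconn : IsConnected A) {x y : X} (hx : x ∈ A) (hy : y ∈ A) {ρ : ℝ}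
    (hρ : 0 < ρ) (hxy : ρ < dist x y) :
    ∃ C ⊆ A, C ⊆ closedBall x ρ ∧ IsLargeContinuum ρ C := by
  set K : Set X := A ∩ closedBall x ρ with hK
  have hKc : IsCompact K := hA.inter_right isClosed_closedBall
  have : CompactSpace K := isCompact_iff_compactSpace.mp hKc
  let x₀ : K := ⟨x, hx, mem_closedBall_self hρ.le⟩
  let C : Set K := connectedComponent x₀
  have hreach : ∃ z ∈ C, ρ ≤ dist x (z : X) := by
    by_contra! hlt
    let U : Set K := {z | dist x (z : X) < ρ}
    have hU : IsOpen U := isOpen_lt (by fun_prop) continuous_const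
    -- The component is the intersection of its clopen neighbourhoods, so one of them avoids the
    -- sphere; such a set is clopen in `A` as well.
    obtain ⟨⟨Z, hZ, hxZ⟩, hZU⟩ : ∃ s : {s : Set K // IsClopen s ∧ x₀ ∈ s}, s.val ⊆ U := by
      have : Nonempty {s : Set K // IsClopen s ∧ x₀ ∈ s} := ⟨⟨univ, isClopen_univ, mem_univ _⟩⟩
      refine exists_subset_nhds_of_compactSpace ?_ (fun s => s.2.1.1) ?_
      · rintro ⟨s, hs, hxs⟩ ⟨t, ht, hxt⟩
        exact ⟨⟨s ∩ t, hs.inter ht, hxs, hxt⟩, inter_subset_left, inter_subset_right⟩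
      · intro z hz
        rw [← connectedComponent_eq_iInter_isClopen] at hz
        exact hU.mem_nhds (hlt z hz)
    have hcl : ∀ s : Set K, IsClosed s → IsClosed (Subtype.val '' s) := fun s hs =>
      (hs.isCompact.image continuous_subtype_val).isClosed
    obtain ⟨w, -, ⟨z, hzZ, rfl⟩, hw⟩ := isPreconnected_closed_iff.mp hconn.isPreconnected
      (Subtype.val '' Z) (Subtype.val '' Zᶜ ∪ {z | ρ ≤ dist x z}) (hcl Z hZ.1)
      ((hcl _ hZ.compl.1).union (isClosed_le continuous_const (by fun_prop)))
      (by
        intro a ha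
        by_cases haK : a ∈ closedBall x ρ
        · by_cases haZ : (⟨a, ha, haK⟩ : K) ∈ Z
          · exact Or.inl ⟨_, haZ, rfl⟩
          · exact Or.inr (Or.inl ⟨_, haZ, rfl⟩)
        · rw [mem_closedBall', not_le] at haK
          exact Or.inr (Or.inr haK.le))
      ⟨x, hx, x₀, hxZ, rfl⟩ ⟨y, hy, Or.inr hxy.le⟩
    rcases hw with ⟨z', hz', hzz'⟩ | hw
    · exact hz' (Subtype.val_injective hzz' ▸ hzZ)
    · exact absurd (show dist x (z : X) < ρ from hZU hzZ) (not_lt.mpr hw)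
  obtain ⟨z, hzC, hz⟩ := hreach
  refine ⟨Subtype.val '' C, ?_, ?_, ?_, ?_, x, ⟨x₀, mem_connectedComponent, rfl⟩, z, ⟨z, hzC, rfl⟩,
    hz⟩
  · rintro _ ⟨w, -, rfl⟩
    exact w.2.1
  · rintro _ ⟨w, -, rfl⟩
    exact w.2.2
  · exact isClosed_connectedComponent.isCompact.image continuous_subtype_val
  · exact isConnected_connectedComponent.image _ continuous_subtype_val.continuousOn

/-- Large continua lying in the members of a decreasing sequence of closed sets accumulate on a
large continuum in its intersection. The latter is the limit of the former in the Vietoris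
topology along an ultrafilter. -/
theorem exists_isLargeContinuum_subset_iInter {X : Type*} [MetricSpace X] [CompactSpace X] {δ : ℝ}
    {Q : ℕ → Set X} (hQ : ∀ n, IsClosed (Q n)) (hanti : Antitone Q)
    (h : ∀ n, ∃ D ⊆ Q n, IsLargeContinuum δ D) :
    ∃ D, (∀ n, D ⊆ Q n) ∧ IsLargeContinuum δ D := by
  choose D hDQ hDc hDconn x hx y hy hxy using h
  let 𝒰 : Ultrafilter ℕ := hyperfilter ℕ
  have h𝒰 : (𝒰 : Filter ℕ) ≤ atTop := Nat.hyperfilter_le_atTop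
  let E : Set X := {z | ∀ U ∈ 𝓝 z, ∀ᶠ n in 𝒰, (D n ∩ U).Nonempty}
  have hlim : ∀ z : ℕ → X, ∃ a, Tendsto z 𝒰 (𝓝 a) := by
    intro z
    obtain ⟨a, -, ha⟩ := isCompact_univ.ultrafilter_le_nhds (𝒰.map z) (by simp)
    exact ⟨a, ha⟩
  have hmem : ∀ (z : ℕ → X) (a : X), (∀ᶠ n in 𝒰, z n ∈ D n) → Tendsto z 𝒰 (𝓝 a) → a ∈ E := by
    intro z a hz ha U hU
    filter_upwards [hz, ha hU] with n h1 h2 using ⟨z n, h1, h2⟩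
  have hopen : ∀ O : Set X, IsOpen O → E ⊆ O → ∀ᶠ n in 𝒰, D n ⊆ O := by
    intro O hO hEO
    by_contra hcon
    rw [← Ultrafilter.eventually_not] at hcon
    have hz : ∀ n, ∃ z, ¬ D n ⊆ O → z ∈ D n ∧ z ∉ O := by
      intro n
      by_cases hn : D n ⊆ O
      · exact ⟨x n, fun h => absurd hn h⟩
      · obtain ⟨z, hz⟩ := not_subset.mp hn
        exact ⟨z, fun _ => hz⟩
    choose z hz using hz
    obtain ⟨a, ha⟩ := hlim z
    have haE : a ∈ E := hmem z a (hcon.mono fun n hn => (hz n hn).1) ha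
    have haO : a ∈ Oᶜ :=
      hO.isClosed_compl.mem_of_tendsto ha (hcon.mono fun n hn => (hz n hn).2)
    exact haO (hEO haE)
  have hEcl : IsClosed E := by
    rw [← isOpen_compl_iff, isOpen_iff_mem_nhds]
    intro z hz
    simp only [E, mem_compl_iff, mem_ofPred_eq, not_forall] at hz
    obtain ⟨U, hU, hzU⟩ := hz
    filter_upwards [eventually_mem_nhds_iff.mpr hU] with w hw hwE
    exact hzU (hwE U hw)
  obtain ⟨a, ha⟩ := hlim x
  obtain ⟨b, hb⟩ := hlim y
  have haE : a ∈ E := hmem x a (Eventually.of_forall hx) ha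
  have hbE : b ∈ E := hmem y b (Eventually.of_forall hy) hb
  refine ⟨E, ?_, hEcl.isCompact, ⟨⟨a, haE⟩, ?_⟩, a, haE, b, hbE, ?_⟩
  · intro m z hz
    by_contra hzm
    have h1 := hz _ ((hQ m).isOpen_compl.mem_nhds hzm)
    obtain ⟨n, ⟨w, hwD, hwQ⟩, hn⟩ := (h1.and (h𝒰 (eventually_ge_atTop m))).exists
    exact hwQ (hanti hn (hDQ n hwD))
  · rw [isPreconnected_closed_iff]
    rintro u v hu hv huv ⟨p, hpE, hpu⟩ ⟨q, hqE, hqv⟩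
    by_contra hempty
    obtain ⟨U, V, hU, hV, hEU, hEV, hUV⟩ := normal_separation (hEcl.inter hu) (hEcl.inter hv)
      (Set.disjoint_left.mpr fun z hz hz' => hempty ⟨z, hz.1, hz.2, hz'.2⟩)
    obtain ⟨n, ⟨h1, h2⟩, h3⟩ := (((hpE U (hU.mem_nhds (hEU ⟨hpE, hpu⟩))).and
      (hqE V (hV.mem_nhds (hEV ⟨hqE, hqv⟩)))).and (hopen (U ∪ V) (hU.union hV) fun z hz =>
        (huv hz).imp (fun h => hEU ⟨hz, h⟩) fun h => hEV ⟨hz, h⟩)).exists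
    obtain ⟨z, -, hzU, hzV⟩ := (hDconn n).isPreconnected U V hU hV h3 h1 h2
    exact Set.disjoint_left.mp hUV hzU hzV
  · exact ge_of_tendsto (ha.dist hb) (Eventually.of_forall hxy)

/-! ### Growth of powers of a finite set -/

section Growth

variable {G : Type*} [Group G]

theorem exists_length_eq_wordLength {S : Set G} (hS : Subgroup.closure S = ⊤) (g : G) :
    ∃ l : List G, l.length = wordLength S g ∧ (∀ x ∈ l, x ∈ S ∨ x⁻¹ ∈ S) ∧ l.prod = g := by
  have hmem : g ∈ Submonoid.closure (S ∪ S⁻¹) := by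
    rw [← Subgroup.closure_toSubmonoid, hS]
    exact Subgroup.mem_top g
  obtain ⟨l, hl, hg⟩ := Submonoid.exists_list_of_mem_closure hmem
  exact Nat.sInf_mem (s := {n : ℕ | ∃ l : List G, l.length = n ∧ (∀ x ∈ l, x ∈ S ∨ x⁻¹ ∈ S) ∧
    l.prod = g}) ⟨l.length, l, rfl, hl, hg⟩

theorem wordLength_mul_le {S : Set G} (hS : Subgroup.closure S = ⊤) (g h : G) :
    wordLength S (g * h) ≤ wordLength S g + wordLength S h := by
  obtain ⟨l, hl, hlS, hlg⟩ := exists_length_eq_wordLength hS g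
  obtain ⟨m, hm, hmS, hmh⟩ := exists_length_eq_wordLength hS h
  refine Nat.sInf_le ⟨l ++ m, by simp [hl, hm], ?_, by simp [hlg, hmh]⟩
  intro x hx
  rcases List.mem_append.mp hx with hx | hx
  exacts [hlS x hx, hmS x hx]

theorem wordLength_one (S : Set G) : wordLength S (1 : G) = 0 :=
  Nat.eq_zero_of_le_zero (Nat.sInf_le ⟨[], by simp⟩)

theorem finite_setOf_wordLength_le {S : Set G} (hfin : S.Finite) (hS : Subgroup.closure S = ⊤)
    (k : ℕ) : {g : G | wordLength S g ≤ k}.Finite := by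
  have hT : (S ∪ S⁻¹).Finite := hfin.union hfin.inv
  have : Finite (S ∪ S⁻¹ : Set G) := hT
  refine ((List.finite_length_le (S ∪ S⁻¹ : Set G) k).image
    fun l => (l.map Subtype.val).prod).subset ?_
  intro g hg
  obtain ⟨l, hl, hlS, hlg⟩ := exists_length_eq_wordLength hS g
  refine ⟨l.attach.map fun x => ⟨x.1, hlS x.1 x.2⟩, ?_, ?_⟩
  · simpa [hl] using hg
  · simpa [Function.comp_def] using hlg

/-- In a group of subexponential growth the cardinalities of the powers of a finite set grow
slower than any exponential; the rate `4 / 3` suffices below. -/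
theorem summable_card_pow_of_hasSubexponentialGrowth [DecidableEq G]
    (hG : HasSubexponentialGrowth G) (F : Finset G) :
    Summable fun t : ℕ => ((F ^ t).card : ℝ) * (3 / 4) ^ t := by
  obtain ⟨S, hfin, hS, L, hL1, hL⟩ := hG
  obtain ⟨N, hN⟩ : ∃ N, ∀ f ∈ F, wordLength S f ≤ N :=
    ⟨F.sup (wordLength S), fun f hf => Finset.le_sup hf⟩
  have hpow : ∀ t, ∀ g ∈ F ^ t, wordLength S g ≤ (N + 1) * t := by
    intro t
    induction t with
    | zero =>
      intro g hg
      rw [pow_zero, Finset.mem_one] at hg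
      simp [hg, wordLength_one]
    | succ t ih =>
      intro g hg
      rw [pow_succ] at hg
      obtain ⟨a, ha, f, hf, rfl⟩ := Finset.mem_mul.mp hg
      have h1 := wordLength_mul_le hS a f
      have h2 := ih a ha
      have h3 := hN f hf
      nlinarith
  have hcard : ∀ t, (F ^ t).card ≤ growthFunction S ((N + 1) * t) := by
    intro t
    rw [growthFunction, ← Set.ncard_coe_finset]
    exact Set.ncard_le_ncard (fun g hg => hpow t g hg) (finite_setOf_wordLength_le hfin hS _)
  -- `u > 1` is chosen so that `u ^ (N + 1) * (3 / 4) = 9 / 10`.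
  set u : ℝ := (6 / 5 : ℝ) ^ (1 / ((N + 1 : ℕ) : ℝ)) with hu
  have hu1 : 1 < u := Real.one_lt_rpow (by norm_num) (by positivity)
  have huN : u ^ (N + 1) = 6 / 5 := by
    rw [hu, one_div, Real.rpow_inv_natCast_pow (by norm_num) (by omega)]
  have hev : ∀ᶠ k : ℕ in atTop, (growthFunction S k : ℝ) ≤ u ^ k := by
    filter_upwards [hL.eventually_lt_const (hL1.trans_lt hu1), eventually_gt_atTop 0] with k hk hk0
    have h1 := pow_le_pow_left₀ (by positivity) hk.le k
    rwa [one_div, Real.rpow_inv_natCast_pow (by positivity) (by omega)] at h1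
  have htend : Tendsto (fun t : ℕ => (N + 1) * t) atTop atTop :=
    tendsto_id.const_mul_atTop' (by omega)
  refine Summable.of_norm_bounded_eventually_nat
    (summable_geometric_of_lt_one (r := (9 / 10 : ℝ)) (by norm_num) (by norm_num)) ?_
  filter_upwards [htend.eventually hev] with t ht
  rw [Real.norm_of_nonneg (by positivity)]
  calc ((F ^ t).card : ℝ) * (3 / 4) ^ t ≤ u ^ ((N + 1) * t) * (3 / 4) ^ t := by
        gcongr
        exact le_trans (by exact_mod_cast hcard t) ht
    _ = (9 / 10) ^ t := by
        rw [pow_mul, huN, ← mul_pow]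
        norm_num

end Growth

/-! ### Splits and their weights -/

/-- One step of a coding of subcontinua: after `gap` elementary moves, composing to the group
element `elt`, a continuum is split into a part near `left` and a part near `right`. -/
structure Split (G X : Type*) where
  gap : ℕ
  elt : G
  left : X
  right : X

namespace Split

variable {G X : Type*} [Group G]

/-- The centre selected by a binary digit. -/
def center (e : Split G X) (b : Bool) : X := if b then e.right else e.left

/-- The split preceded by one further elementary move `g`. -/
def delay (g : G) (e : Split G X) : Split G X := ⟨e.gap + 1, e.elt * g, e.left, e.right⟩

theorem delay_injective (g : G) : Function.Injective (delay g : Split G X → Split G X) := by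
  rintro ⟨t, h, z, z'⟩ ⟨t', h', w, w'⟩ heq
  simpa [delay] using heq

variable [MetricSpace X]

/-- The splits with moves in `F` and centres in `Z` whose two balls of radius `ρ` are disjoint.
The gap is positive. -/
def IsAdmissible [DecidableEq G] (F : Finset G) (Z : Finset X) (ρ : ℝ) (e : Split G X) : Prop :=
  1 ≤ e.gap ∧ e.elt ∈ F ^ e.gap ∧ e.left ∈ Z ∧ e.right ∈ Z ∧ 2 * ρ < dist e.left e.right

theorem IsAdmissible.delay [DecidableEq G] {F : Finset G} {Z : Finset X} {ρ : ℝ} {e : Split G X}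
    (he : e.IsAdmissible F Z ρ) {g : G} (hg : g ∈ F) : (e.delay g).IsAdmissible F Z ρ := by
  obtain ⟨-, h2, h3⟩ := he
  exact ⟨Nat.le_add_left 1 e.gap, pow_succ F e.gap ▸ Finset.mul_mem_mul h2 hg, h3⟩

theorem finite_setOf_isAdmissible_gap_le [DecidableEq G] (F : Finset G) (Z : Finset X) (ρ : ℝ)
    (n : ℕ) : {e : Split G X | e.IsAdmissible F Z ρ ∧ e.gap ≤ n}.Finite := by
  refine ((Finset.range (n + 1)).finite_toSet.biUnion fun t _ =>
    (((F ^ t) ×ˢ Z ×ˢ Z).finite_toSet.image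
      fun q : G × X × X => (⟨t, q.1, q.2.1, q.2.2⟩ : Split G X))).subset ?_
  rintro ⟨t, h, z, z'⟩ ⟨⟨-, h2, h3, h4, -⟩, ht⟩
  simp only [mem_iUnion]
  refine ⟨t, by simpa using Nat.lt_succ_of_le ht, (h, z, z'), ?_, rfl⟩
  exact Finset.mem_coe.mpr
    (Finset.mem_product.mpr ⟨h2, Finset.mem_product.mpr ⟨h3, h4⟩⟩)

theorem sum_gap_weight_le [DecidableEq G] {F : Finset G} {Z : Finset X} {ρ : ℝ}
    (hsum : Summable fun t : ℕ => ((F ^ t).card : ℝ) * (3 / 4) ^ t) (H : Finset (Split G X))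
    (hH : ∀ e ∈ H, e.IsAdmissible F Z ρ) :
    ∑ e ∈ H, (3 / 4 : ℝ) ^ e.gap ≤
      (Z.card : ℝ) ^ 2 * ∑' t : ℕ, ((F ^ t).card : ℝ) * (3 / 4) ^ t := by
  classical
  have hfiber : ∀ t, (H.filter fun e => e.gap = t).card ≤ (F ^ t).card * Z.card ^ 2 := by
    intro t
    have : ((F ^ t) ×ˢ Z ×ˢ Z).card = (F ^ t).card * Z.card ^ 2 := by
      simp [Finset.card_product, sq]
    rw [← this]
    refine Finset.card_le_card_of_injOn (fun e => (e.elt, e.left, e.right)) ?_ ?_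
    · intro e he
      obtain ⟨heH, rfl⟩ := Finset.mem_filter.mp he
      obtain ⟨-, h2, h3, h4, -⟩ := hH e heH
      exact Finset.mem_coe.mpr
        (Finset.mem_product.mpr ⟨h2, Finset.mem_product.mpr ⟨h3, h4⟩⟩)
    · rintro ⟨t₁, h, z, z'⟩ h₁ ⟨t₂, k, w, w'⟩ h₂ heq
      obtain ⟨-, rfl⟩ := Finset.mem_filter.mp h₁
      obtain ⟨-, rfl⟩ := Finset.mem_filter.mp h₂
      simpa using heq
  rw [Finset.sum_comp (fun t : ℕ => (3 / 4 : ℝ) ^ t) Split.gap, ← tsum_mul_left]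
  refine le_trans (Finset.sum_le_sum fun t _ => ?_)
    ((hsum.mul_left ((Z.card : ℝ) ^ 2)).sum_le_tsum _ fun t _ => by positivity)
  rw [nsmul_eq_mul, ← mul_assoc]
  gcongr
  rw [mul_comm]
  exact_mod_cast hfiber t

end Split

/-- If the weights of the letters add up to at most `1 / 2`, the multiplicative weights of the words
add up to at most `1 + 1 / 2 + 1 / 4 + ⋯ = 2`. -/
theorem sum_prod_map_le_two {α : Type*} {w : α → ℝ} (hw : ∀ a, 0 ≤ w a) {P : α → Prop}
    (hP : ∀ H : Finset α, (∀ a ∈ H, P a) → ∑ a ∈ H, w a ≤ 1 / 2) (T : Finset (List α))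
    (hT : ∀ p ∈ T, ∀ a ∈ p, P a) : ∑ p ∈ T, (p.map w).prod ≤ 2 := by
  classical
  have key : ∀ (n : ℕ) (T : Finset (List α)), (∀ p ∈ T, ∀ a ∈ p, P a) →
      (∀ p ∈ T, p.length ≤ n) → ∑ p ∈ T, (p.map w).prod ≤ 2 := by
    intro n
    have hnn : ∀ p : List α, 0 ≤ (p.map w).prod := fun p =>
      List.prod_nonneg fun x hx => by
        obtain ⟨a, -, rfl⟩ := List.mem_map.mp hx
        exact hw a
    induction n with
    | zero =>
      intro T _ hlen
      have hsub : T ⊆ {[]} := fun p hp => by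
        simpa using hlen p hp
      refine (Finset.sum_le_sum_of_subset_of_nonneg hsub fun p _ _ => hnn p).trans ?_
      norm_num
    | succ n ih =>
      intro T hTP hlen
      let C : Finset (List α) := T.erase []
      let heads : Finset α := C.biUnion fun p => p.head?.toFinset
      let tails : Finset (List α) := C.image List.tail
      have hC : ∀ p ∈ C, ∃ a q, p = a :: q ∧ p ∈ T := by
        intro p hp
        obtain ⟨hne, hpT⟩ := Finset.mem_erase.mp hp
        obtain ⟨a, q, rfl⟩ := List.exists_cons_of_ne_nil hne
        exact ⟨a, q, rfl, hpT⟩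
      have hheads : ∑ a ∈ heads, w a ≤ 1 / 2 := by
        refine hP _ fun a ha => ?_
        obtain ⟨p, hp, hap⟩ := Finset.mem_biUnion.mp ha
        obtain ⟨b, q, rfl, hpT⟩ := hC p hp
        obtain rfl : a = b := by simpa using hap
        exact hTP _ hpT a List.mem_cons_self
      have htails : ∑ q ∈ tails, (q.map w).prod ≤ 2 := by
        refine ih _ ?_ ?_
        · intro q hq a ha
          obtain ⟨p, hp, rfl⟩ := Finset.mem_image.mp hq
          obtain ⟨b, q, rfl, hpT⟩ := hC p hp
          exact hTP _ hpT a (List.mem_cons_of_mem _ ha)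
        · intro q hq
          obtain ⟨p, hp, rfl⟩ := Finset.mem_image.mp hq
          obtain ⟨b, q, rfl, hpT⟩ := hC p hp
          simpa using hlen _ hpT
      have hsub : T ⊆ insert [] ((heads ×ˢ tails).image fun x => x.1 :: x.2) := by
        intro p hp
        by_cases hne : p = []
        · simp [hne]
        · have hpC : p ∈ C := Finset.mem_erase.mpr ⟨hne, hp⟩
          obtain ⟨a, q, rfl, -⟩ := hC p hpC
          refine Finset.mem_insert_of_mem (Finset.mem_image.mpr ⟨(a, q), ?_, rfl⟩)
          refine Finset.mem_product.mpr ⟨Finset.mem_biUnion.mpr ⟨_, hpC, by simp⟩,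
            Finset.mem_image.mpr ⟨_, hpC, rfl⟩⟩
      have himage : ∑ p ∈ (heads ×ˢ tails).image (fun x => x.1 :: x.2), (p.map w).prod =
          (∑ a ∈ heads, w a) * ∑ q ∈ tails, (q.map w).prod := by
        rw [Finset.sum_image, Finset.sum_mul_sum, Finset.sum_product]
        · simp
        · rintro ⟨a, q⟩ - ⟨b, r⟩ - h
          simpa using h
      refine (Finset.sum_le_sum_of_subset_of_nonneg hsub fun p _ _ => hnn p).trans ?_
      rw [Finset.sum_insert (by simp), himage]
      have h0 : 0 ≤ ∑ q ∈ tails, (q.map w).prod := Finset.sum_nonneg fun q _ => hnn q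
      simp only [List.map_nil, List.prod_nil]
      nlinarith
  exact key (T.sup List.length) T hT fun p hp => Finset.le_sup (f := List.length) hp

theorem prod_map_mul_pow_gap {G X : Type*} (y x : ℝ) (p : List (Split G X)) :
    (p.map fun e => y * x ^ e.gap).prod = y ^ p.length * x ^ (p.map Split.gap).sum := by
  induction p with
  | nil => simp
  | cons e p ih =>
    simp only [List.map_cons, List.prod_cons, ih, List.length_cons, List.sum_cons, pow_succ, pow_add]
    ring

/-! ### Shattering -/

section Shatters

variable {G X : Type*} [Group G] [MetricSpace X]

/-- A large continuum `A` shatters a list of splits if every binary choice along the list is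
realised: for both centres of the first split there is a large continuum `D`, close to that centre
and inside the translate of `A`, that shatters the rest of the list. -/
def Shatters (φ : G →* (X ≃ₜ X)) (δ ρ : ℝ) : List (Split G X) → Set X → Prop
  | [], A => IsLargeContinuum δ A
  | e :: p, A => IsLargeContinuum δ A ∧
      ∀ b : Bool, ∃ D ⊆ φ e.elt '' A, D ⊆ closedBall (e.center b) ρ ∧ Shatters φ δ ρ p D

/-- Every large continuum can be moved by an element of `F` so that its image contains two large
continua in disjoint balls of radius `ρ` with centres in `Z`. -/
def IsSplitting (φ : G →* (X ≃ₜ X)) (δ ρ : ℝ) (F : Finset G) (Z : Finset X) : Prop :=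
  ∀ A, IsLargeContinuum δ A → ∃ g ∈ F, ∃ z ∈ Z, ∃ z' ∈ Z, 2 * ρ < dist z z' ∧
    (∃ D ⊆ φ g '' A, D ⊆ closedBall z ρ ∧ IsLargeContinuum δ D) ∧
    ∃ D ⊆ φ g '' A, D ⊆ closedBall z' ρ ∧ IsLargeContinuum δ D

variable {φ : G →* (X ≃ₜ X)} {δ ρ : ℝ}

theorem image_map_mul (φ : G →* (X ≃ₜ X)) (g h : G) (A : Set X) :
    φ (g * h) '' A = φ g '' (φ h '' A) := by
  rw [image_image, map_mul]
  rfl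

theorem Shatters.delay {p : List (Split G X)} {g : G} {A D : Set X} (hA : IsLargeContinuum δ A)
    (hD : D ⊆ φ g '' A) (h : Shatters φ δ ρ p D) :
    Shatters φ δ ρ (p.modifyHead (Split.delay g)) A := by
  cases p with
  | nil => exact hA
  | cons e p =>
    refine ⟨hA, fun b => ?_⟩
    obtain ⟨E, hE, hEb, hEp⟩ := h.2 b
    refine ⟨E, ?_, hEb, hEp⟩
    change E ⊆ φ (e.elt * g) '' A
    rw [image_map_mul]
    exact hE.trans (image_mono hD)

/-- A counting bound of Sauer–Shelah type: a list of splits shattered by only one of the two parts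
of `A` is still shattered by `A`, while a list shattered by both gives two lists, because the
present splitting can be put in front of it. Hence each unit of gap doubles the number of shattered
lists. -/
theorem IsSplitting.exists_finset_shatters [DecidableEq G] {F : Finset G} {Z : Finset X}
    (hsplit : IsSplitting φ δ ρ F Z) (r : ℕ) {A : Set X} (hA : IsLargeContinuum δ A) :
    ∃ T : Finset (List (Split G X)), 2 ^ r ≤ T.card ∧ ∀ p ∈ T,
      (∀ e ∈ p, e.IsAdmissible F Z ρ) ∧ (p.map Split.gap).sum ≤ r ∧ Shatters φ δ ρ p A := by
  classical
  induction r generalizing A with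
  | zero => exact ⟨{[]}, by simp, by simpa [Shatters] using hA⟩
  | succ r ih =>
    obtain ⟨g, hg, z, hz, z', hz', hzz', ⟨D₁, hD₁, hDz, hL₁⟩, D₂, hD₂, hDz', hL₂⟩ := hsplit A hA
    obtain ⟨T₁, hc₁, hT₁⟩ := ih hL₁
    obtain ⟨T₂, hc₂, hT₂⟩ := ih hL₂
    let e : Split G X := ⟨1, g, z, z'⟩
    have he : e.IsAdmissible F Z ρ := ⟨le_rfl, by simpa [e] using hg, hz, hz', hzz'⟩
    have hgood : ∀ (D : Set X) (p : List (Split G X)), D ⊆ φ g '' A →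
        ((∀ e ∈ p, e.IsAdmissible F Z ρ) ∧ (p.map Split.gap).sum ≤ r ∧ Shatters φ δ ρ p D) →
        (∀ e ∈ p.modifyHead (Split.delay g), e.IsAdmissible F Z ρ) ∧
          ((p.modifyHead (Split.delay g)).map Split.gap).sum ≤ r + 1 ∧
          Shatters φ δ ρ (p.modifyHead (Split.delay g)) A := by
      rintro D p hD ⟨hp, hsum, hs⟩
      refine ⟨?_, ?_, hs.delay hA hD⟩
      · cases p with
        | nil => simp
        | cons a p =>
          simp only [List.modifyHead_cons, List.mem_cons, forall_eq_or_imp] at hp ⊢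
          exact ⟨hp.1.delay hg, hp.2⟩
      · cases p with
        | nil => simp
        | cons a p =>
          simp only [List.map_cons, List.sum_cons, List.modifyHead_cons, Split.delay] at hsum ⊢
          omega
    have hinj : Function.Injective (List.modifyHead (Split.delay g : Split G X → Split G X)) := by
      rintro (_ | ⟨a, p⟩) (_ | ⟨b, q⟩) h
      · rfl
      · simp at h
      · simp at h
      · simp only [List.modifyHead_cons, List.cons.injEq] at h
        rw [Split.delay_injective g h.1, h.2]
    have hdisj : Disjoint ((T₁ ∪ T₂).image (List.modifyHead (Split.delay g)))
        ((T₁ ∩ T₂).image (List.cons e)) := by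
      rw [Finset.disjoint_left]
      intro p hp hp'
      obtain ⟨q, hq, rfl⟩ := Finset.mem_image.mp hp
      obtain ⟨q', -, heq⟩ := Finset.mem_image.mp hp'
      cases q with
      | nil => simp at heq
      | cons a q =>
        -- The first gap would be `1` on one side and at least `2` on the other.
        simp only [List.modifyHead_cons, List.cons.injEq] at heq
        have hgap : 1 = a.gap + 1 := congrArg Split.gap heq.1
        have ha : 1 ≤ a.gap := by
          rcases Finset.mem_union.mp hq with hq | hq
          exacts [((hT₁ _ hq).1 a List.mem_cons_self).1, ((hT₂ _ hq).1 a List.mem_cons_self).1]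
        omega
    refine ⟨(T₁ ∪ T₂).image (List.modifyHead (Split.delay g)) ∪ (T₁ ∩ T₂).image (List.cons e),
      ?_, ?_⟩
    · rw [Finset.card_union_of_disjoint hdisj, Finset.card_image_of_injective _ hinj,
        Finset.card_image_of_injective _ List.cons_injective, Finset.card_union_add_card_inter,
        pow_succ]
      omega
    · intro p hp
      rcases Finset.mem_union.mp hp with hp | hp
      · obtain ⟨q, hq, rfl⟩ := Finset.mem_image.mp hp
        rcases Finset.mem_union.mp hq with hq | hq
        exacts [hgood D₁ q hD₁ (hT₁ q hq), hgood D₂ q hD₂ (hT₂ q hq)]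
      · obtain ⟨q, hq, rfl⟩ := Finset.mem_image.mp hp
        obtain ⟨hq₁, hq₂⟩ := Finset.mem_inter.mp hq
        obtain ⟨hadm, hsum, hs₁⟩ := hT₁ q hq₁
        obtain ⟨-, -, hs₂⟩ := hT₂ q hq₂
        refine ⟨?_, ?_, hA, ?_⟩
        · simp only [List.mem_cons, forall_eq_or_imp]
          exact ⟨he, hadm⟩
        · simp only [List.map_cons, List.sum_cons, e]
          omega
        · rintro (_ | _)
          exacts [⟨D₁, hD₁, hDz, hs₁⟩, ⟨D₂, hD₂, hDz', hs₂⟩]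

/-- Shattered lists of positive density: lists of total gap at most `Q * m` and length at most `m`
are too few, by the weights, to make up the `2 ^ (Q * m)` lists that are shattered. -/
theorem IsSplitting.exists_long_shatters [DecidableEq G] {F : Finset G} {Z : Finset X}
    (hsplit : IsSplitting φ δ ρ F Z)
    (hsum : Summable fun t : ℕ => ((F ^ t).card : ℝ) * (3 / 4) ^ t)
    {A : Set X} (hA : IsLargeContinuum δ A) :
    ∃ Q : ℕ, 1 ≤ Q ∧ ∀ m : ℕ, 4 ≤ m → ∃ p : List (Split G X),
      (∀ e ∈ p, e.IsAdmissible F Z ρ) ∧ (p.map Split.gap).sum ≤ Q * m ∧ m < p.length ∧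
        Shatters φ δ ρ p A := by
  set C : ℝ := (Z.card : ℝ) ^ 2 * ∑' t : ℕ, ((F ^ t).card : ℝ) * (3 / 4) ^ t with hC
  have hC0 : 0 ≤ C := mul_nonneg (by positivity) (tsum_nonneg fun t => by positivity)
  set y : ℝ := 1 / (2 * (C + 1)) with hy
  have hy0 : 0 < y := by positivity
  have hy1 : y ≤ 1 := by
    rw [hy, div_le_one (by positivity)]
    linarith
  have hyC : y * C ≤ 1 / 2 := by
    rw [hy, div_mul_eq_mul_div, div_le_div_iff₀ (by positivity) (by norm_num)]
    linarith
  obtain ⟨q, hq⟩ := exists_pow_lt_of_lt_one hy0 (by norm_num : (4 / 5 : ℝ) < 1)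
  have hQ : (4 / 5 : ℝ) ^ (q + 1) ≤ y :=
    (pow_le_pow_of_le_one (by norm_num) (by norm_num) (Nat.le_succ q)).trans hq.le
  refine ⟨q + 1, by omega, fun m hm => ?_⟩
  set r : ℕ := (q + 1) * m with hr
  obtain ⟨T, hcard, hT⟩ := hsplit.exists_finset_shatters r hA
  by_contra! hcon
  have hshort : ∀ p ∈ T, p.length ≤ m := by
    intro p hp
    obtain ⟨h1, h2, h3⟩ := hT p hp
    by_contra! hlen
    exact hcon p h1 h2 hlen h3
  have hle : ∑ p ∈ T, (p.map fun e => y * (3 / 4 : ℝ) ^ e.gap).prod ≤ 2 := by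
    refine sum_prod_map_le_two (P := Split.IsAdmissible F Z ρ) (fun e => by positivity) ?_ T
      fun p hp => (hT p hp).1
    intro H hH
    rw [← Finset.mul_sum]
    exact (mul_le_mul_of_nonneg_left (Split.sum_gap_weight_le hsum H hH) hy0.le).trans hyC
  have hlow : ∀ p ∈ T, (4 / 5 : ℝ) ^ r * (3 / 4) ^ r ≤
      (p.map fun e => y * (3 / 4 : ℝ) ^ e.gap).prod := by
    intro p hp
    rw [prod_map_mul_pow_gap]
    refine mul_le_mul ?_ (pow_le_pow_of_le_one (by norm_num) (by norm_num) (hT p hp).2.1)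
      (by positivity) (by positivity)
    calc (4 / 5 : ℝ) ^ r = ((4 / 5) ^ (q + 1)) ^ m := by rw [hr, pow_mul]
      _ ≤ y ^ m := by gcongr
      _ ≤ y ^ p.length := pow_le_pow_of_le_one hy0.le hy1 (hshort p hp)
  have hbig := (Finset.card_nsmul_le_sum T _ _ hlow).trans hle
  rw [nsmul_eq_mul] at hbig
  have h2 : (2 : ℝ) ^ r * ((4 / 5) ^ r * (3 / 4) ^ r) ≤ 2 :=
    le_trans (by gcongr; exact_mod_cast hcard) hbig
  -- `2 * (4 / 5) * (3 / 4) = 6 / 5` and `(6 / 5) ^ 4 > 2`.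
  rw [← mul_pow, ← mul_pow] at h2
  have h4 : 4 ≤ r := hm.trans (Nat.le_mul_of_pos_left m (by omega))
  have h6 : (6 / 5 : ℝ) ^ 4 ≤ (2 * (4 / 5 * (3 / 4))) ^ r := by
    rw [show (2 * (4 / 5 * (3 / 4)) : ℝ) = 6 / 5 by norm_num]
    exact pow_le_pow_right₀ (by norm_num) h4
  norm_num at h6 h2
  linarith

end Shatters

/-! ### Backward windows with bounded gaps -/

/-- If nonnegative integers have bounded average, there is a position whose `i`-th predecessor is
at most a bound depending on `i` only, simultaneously for all `i < s`: the exceptional positions for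
`i` are at most the fraction `2 ^ -(i + 2)` of `m`. -/
theorem exists_backward_window {t : ℕ → ℕ} {n m Q s : ℕ} (hQ : 1 ≤ Q)
    (hsum : ∑ i ∈ Finset.range n, t i ≤ Q * m) (hn : m < n) (hs : 4 * s ≤ m) :
    ∃ j < n, s ≤ j ∧ ∀ i < s, t (j - i) ≤ Q * 2 ^ (i + 2) := by
  by_contra! hcon
  let B : ℕ → Finset ℕ := fun i => (Finset.Ico s n).filter fun j => Q * 2 ^ (i + 2) < t (j - i)
  have hcover : Finset.Ico s n ⊆ (Finset.range s).biUnion B := by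
    intro j hj
    obtain ⟨h1, h2⟩ := Finset.mem_Ico.mp hj
    obtain ⟨i, hi, hij⟩ := hcon j h2 h1
    exact Finset.mem_biUnion.mpr ⟨i, Finset.mem_range.mpr hi, Finset.mem_filter.mpr ⟨hj, hij⟩⟩
  have hB : ∀ i ∈ Finset.range s, ((B i).card : ℝ) ≤ (m : ℝ) / 4 * (1 / 2) ^ i := by
    intro i hi
    rw [Finset.mem_range] at hi
    have h1 : (B i).card * (Q * 2 ^ (i + 2)) ≤ Q * m := by
      calc (B i).card * (Q * 2 ^ (i + 2)) ≤ ∑ j ∈ B i, t (j - i) := by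
            rw [← smul_eq_mul]
            exact Finset.card_nsmul_le_sum _ _ _ fun j hj => (Finset.mem_filter.mp hj).2.le
        _ = ∑ k ∈ (B i).image (· - i), t k := by
            rw [Finset.sum_image]
            intro a ha b hb hab
            have h1 := (Finset.mem_Ico.mp (Finset.mem_filter.mp ha).1).1
            have h2 := (Finset.mem_Ico.mp (Finset.mem_filter.mp hb).1).1
            simp only at hab
            omega
        _ ≤ ∑ k ∈ Finset.range n, t k := by
            refine Finset.sum_le_sum_of_subset fun k hk => ?_
            obtain ⟨j, hj, rfl⟩ := Finset.mem_image.mp hk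
            have := (Finset.mem_Ico.mp (Finset.mem_filter.mp hj).1).2
            exact Finset.mem_range.mpr (by omega)
        _ ≤ Q * m := hsum
    have h2 : (B i).card * 2 ^ (i + 2) ≤ m := by
      refine Nat.le_of_mul_le_mul_left (c := Q) ?_ hQ
      linarith
    have h3 : ((B i).card : ℝ) * (2 ^ i * 4) ≤ m := by
      have : ((B i).card : ℝ) * 2 ^ (i + 2) ≤ m := by exact_mod_cast h2
      rw [pow_add] at this
      linarith
    rw [div_mul_eq_mul_div, one_div, inv_pow, ← div_eq_mul_inv, div_div, le_div_iff₀ (by positivity)]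
    exact h3
  have hcard : ((n - s : ℕ) : ℝ) ≤ m / 2 := by
    calc ((n - s : ℕ) : ℝ) ≤ ∑ i ∈ Finset.range s, ((B i).card : ℝ) := by
          rw [← Nat.card_Ico]
          exact_mod_cast (Finset.card_le_card hcover).trans Finset.card_biUnion_le
      _ ≤ ∑ i ∈ Finset.range s, (m : ℝ) / 4 * (1 / 2) ^ i := Finset.sum_le_sum hB
      _ = (m : ℝ) / 4 * ∑ i ∈ Finset.range s, (1 / 2 : ℝ) ^ i := by rw [Finset.mul_sum]
      _ ≤ (m : ℝ) / 4 * 2 := by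
          gcongr
          exact sum_geometric_two_le s
      _ = m / 2 := by ring
  have h2 : 2 * (n - s) ≤ m := by
    have : (2 : ℝ) * ((n - s : ℕ) : ℝ) ≤ m := by linarith
    exact_mod_cast this
  omega

/-! ### Backward coding sequences -/

section Coding

variable {G X : Type*} [Group G]

/-- The group element that carries the stage before the last `i` splits to the present, for a
sequence of splits read backwards in time: the later factors stand on the left. -/
def prefixProd (e : ℕ → Split G X) (i : ℕ) : G := ((List.range i).map fun k => (e k).elt).prod

theorem prefixProd_succ (e : ℕ → Split G X) (i : ℕ) :
    prefixProd e (i + 1) = prefixProd e i * (e i).elt := by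
  simp [prefixProd, List.range_succ]

theorem prefixProd_congr {e e' : ℕ → Split G X} {i : ℕ} (h : ∀ k < i, e k = e' k) :
    prefixProd e i = prefixProd e' i := by
  unfold prefixProd
  congr 1
  exact List.map_congr_left fun k hk => by rw [h k (List.mem_range.mp hk)]

variable [MetricSpace X]

theorem Shatters.exists_chain {φ : G →* (X ≃ₜ X)} {δ ρ : ℝ} {p : List (Split G X)} {A : Set X}
    (h : Shatters φ δ ρ p A) (σ : ℕ → Bool) :
    ∃ D : ℕ → Set X, D 0 = A ∧ (∀ i ≤ p.length, IsLargeContinuum δ (D i)) ∧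
      ∀ i (hi : i < p.length), D (i + 1) ⊆ φ (p[i]).elt '' D i ∧
        D (i + 1) ⊆ closedBall ((p[i]).center (σ i)) ρ := by
  induction p generalizing A σ with
  | nil =>
    refine ⟨fun _ => A, rfl, fun _ _ => h, fun i hi => ?_⟩
    simp at hi
  | cons e p ih =>
    obtain ⟨B, hBA, hB, hs⟩ := h.2 (σ 0)
    obtain ⟨D, hD0, hDl, hD⟩ := ih hs fun i => σ (i + 1)
    refine ⟨fun i => Nat.casesOn i A D, rfl, ?_, ?_⟩
    · rintro (_ | i) hi
      · exact h.1
      · exact hDl i (by simpa using hi)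
    · rintro (_ | i) hi
      · subst hD0
        exact ⟨hBA, hB⟩
      · exact hD i (by simpa using hi)

/-- The cylinder of a binary word: the points whose first `n` digits, read off from a sequence of
splits backwards in time, are those of `σ`. -/
def cylinder (φ : G →* (X ≃ₜ X)) (ρ : ℝ) (e : ℕ → Split G X) (σ : ℕ → Bool) (n : ℕ) : Set X :=
  ⋂ i < n, φ (prefixProd e i) '' closedBall ((e i).center (σ i)) ρ

variable {φ : G →* (X ≃ₜ X)} {δ ρ : ℝ}

theorem cylinder_congr {e e' : ℕ → Split G X} {n : ℕ} (h : ∀ i < n, e i = e' i) (σ : ℕ → Bool) :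
    cylinder φ ρ e σ n = cylinder φ ρ e' σ n := by
  refine iInter₂_congr fun i hi => ?_
  rw [h i hi, prefixProd_congr fun k hk => h k (hk.trans hi)]

theorem antitone_cylinder (e : ℕ → Split G X) (σ : ℕ → Bool) :
    Antitone (cylinder φ ρ e σ) := fun _ _ hmn =>
  biInter_subset_biInter_left fun _ hi => lt_of_lt_of_le hi hmn

theorem isClosed_cylinder (e : ℕ → Split G X) (σ : ℕ → Bool) (n : ℕ) :
    IsClosed (cylinder φ ρ e σ n) :=
  isClosed_biInter fun i _ => (φ (prefixProd e i)).isClosedMap _ isClosed_closedBall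

/-- Finite backward codings of any length `s`, with a bound on the `i`-th gap that does not depend
on `s`. -/
theorem IsSplitting.exists_finite_coding [DecidableEq G] {F : Finset G} {Z : Finset X}
    (hsplit : IsSplitting φ δ ρ F Z)
    (hsum : Summable fun t : ℕ => ((F ^ t).card : ℝ) * (3 / 4) ^ t)
    {A : Set X} (hA : IsLargeContinuum δ A) :
    ∃ L : ℕ → ℕ, ∀ s : ℕ, ∃ e : ℕ → Split G X,
      (∀ i < s, (e i).IsAdmissible F Z ρ ∧ (e i).gap ≤ L i) ∧
        ∀ σ : ℕ → Bool, ∃ D ⊆ cylinder φ ρ e σ s, IsLargeContinuum δ D := by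
  obtain ⟨Q, hQ, hlong⟩ := hsplit.exists_long_shatters hsum hA
  refine ⟨fun i => Q * 2 ^ (i + 2), fun s => ?_⟩
  obtain ⟨p, hadm, hgap, hlen, hp⟩ := hlong (4 * s + 4) (by omega)
  let u : ℕ → Split G X := fun i => if h : i < p.length then p[i] else p[0]
  have hu : ∀ i (hi : i < p.length), u i = p[i] := fun i hi => dif_pos hi
  have hugap : ∑ i ∈ Finset.range p.length, (u i).gap ≤ Q * (4 * s + 4) := by
    refine le_of_eq_of_le ?_ hgap
    rw [← Fin.sum_univ_fun_getElem, Finset.sum_range]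
    exact Finset.sum_congr rfl fun i _ => by rw [hu i i.2]
  obtain ⟨j, hj, hsj, hwin⟩ := exists_backward_window hQ hugap hlen (by omega : 4 * s ≤ 4 * s + 4)
  refine ⟨fun i => u (j - i), fun i hi => ⟨?_, hwin i hi⟩, fun σ => ?_⟩
  · change (u (j - i)).IsAdmissible F Z ρ
    rw [hu (j - i) (by omega)]
    exact hadm _ (List.getElem_mem _)
  · obtain ⟨D, -, hDl, hD⟩ := hp.exists_chain fun k => σ (j - k)
    have hback : ∀ i ≤ j, D (j + 1) ⊆ φ (prefixProd (fun i => u (j - i)) i) '' D (j + 1 - i) := by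
      intro i
      induction i with
      | zero =>
        intro _
        rw [show prefixProd (fun i => u (j - i)) 0 = 1 from rfl, map_one]
        exact (image_id _).symm.subset
      | succ i ih =>
        intro hi
        refine (ih (by omega)).trans ?_
        rw [prefixProd_succ, image_map_mul]
        refine image_mono ?_
        have h1 := (hD (j - i) (by omega)).1
        rw [← hu (j - i) (by omega), show j - i + 1 = j + 1 - i by omega,
          show j - i = j + 1 - (i + 1) by omega] at h1
        rwa [show j - i = j + 1 - (i + 1) by omega]
    refine ⟨D (j + 1), subset_iInter₂ fun i hi => ?_, hDl _ hj⟩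
    refine (hback i (by omega)).trans (image_mono ?_)
    have h2 := (hD (j - i) (by omega)).2
    rwa [← hu (j - i) (by omega), show j - i + 1 = j + 1 - i by omega,
      show j - (j - i) = i by omega] at h2

/-- An infinite backward coding: by compactness there is one sequence of splits for which every
infinite binary word is realised by a large continuum. -/
theorem IsSplitting.exists_coding [CompactSpace X] [DecidableEq G] {F : Finset G} {Z : Finset X}
    (hsplit : IsSplitting φ δ ρ F Z)
    (hsum : Summable fun t : ℕ => ((F ^ t).card : ℝ) * (3 / 4) ^ t)
    {A : Set X} (hA : IsLargeContinuum δ A) :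
    ∃ e : ℕ → Split G X, (∀ i, (e i).IsAdmissible F Z ρ) ∧
      ∀ σ : ℕ → Bool, ∃ D, (∀ n, D ⊆ cylinder φ ρ e σ n) ∧ IsLargeContinuum δ D := by
  obtain ⟨L, hL⟩ := hsplit.exists_finite_coding hsum hA
  choose f hf hfD using hL
  let 𝒰 : Ultrafilter ℕ := hyperfilter ℕ
  have hge : ∀ i : ℕ, ∀ᶠ s in (𝒰 : Filter ℕ), i < s := fun i =>
    Nat.hyperfilter_le_atTop (eventually_gt_atTop i)
  -- Each entry ranges over a finite set, so it has an ultralimit that is attained.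
  have hconst : ∀ i, ∃ a : Split G X, a.IsAdmissible F Z ρ ∧ ∀ᶠ s in 𝒰, f s i = a := by
    intro i
    obtain ⟨a, ha, hfa⟩ := (Ultrafilter.eventually_exists_mem_iff (f := 𝒰)
      (P := fun a s => f s i = a)
      (Split.finite_setOf_isAdmissible_gap_le F Z ρ (L i))).mp
      ((hge i).mono fun s hs => ⟨f s i, hf s i hs, rfl⟩)
    exact ⟨a, ha.1, hfa⟩
  choose e he hfe using hconst
  refine ⟨e, he, fun σ => exists_isLargeContinuum_subset_iInter (isClosed_cylinder e σ)
    (antitone_cylinder e σ) fun n => ?_⟩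
  have hall : ∀ᶠ s in 𝒰, ∀ i ∈ Finset.range n, f s i = e i :=
    (Filter.eventually_all_finset _).mpr fun i _ => hfe i
  obtain ⟨s, hs, hns⟩ := (hall.and (hge n)).exists
  obtain ⟨D, hD, hDl⟩ := hfD s σ
  refine ⟨D, (hD.trans (antitone_cylinder _ σ hns.le)).trans_eq ?_, hDl⟩
  exact cylinder_congr (fun i hi => hs i (Finset.mem_range.mpr hi)) σ

theorem disjoint_iInter_cylinder {e : ℕ → Split G X} (he : ∀ i, 2 * ρ < dist (e i).left (e i).right)
    {σ τ : ℕ → Bool} (h : σ ≠ τ) :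
    Disjoint (⋂ n, cylinder φ ρ e σ n) (⋂ n, cylinder φ ρ e τ n) := by
  obtain ⟨i, hi⟩ := Function.ne_iff.mp h
  have hsub : ∀ υ : ℕ → Bool, ⋂ n, cylinder φ ρ e υ n ⊆
      φ (prefixProd e i) '' closedBall ((e i).center (υ i)) ρ := fun υ =>
    (iInter_subset _ (i + 1)).trans (biInter_subset_of_mem (Nat.lt_succ_self i))
  refine Disjoint.mono (hsub σ) (hsub τ) ?_
  rw [disjoint_image_iff (φ (prefixProd e i)).injective]
  have hball : Disjoint (closedBall (e i).left ρ) (closedBall (e i).right ρ) :=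
    closedBall_disjoint_closedBall (by linarith [he i])
  cases hσ : σ i <;> cases hτ : τ i
  · exact absurd (hσ.trans hτ.symm) hi
  · simpa [Split.center] using hball
  · simpa [Split.center] using hball.symm
  · exact absurd (hσ.trans hτ.symm) hi

/-! ### Expansive actions split large continua -/

/-- The constants come from an expansivity constant `c`: a continuum of diameter more than `c`
contains continua of diameter `c / 4` in the balls of radius `c / 4` about two points at distance
more than `c`, and replacing these points by points of a `c / 8`-net costs `c / 8` in the radius. -/
theorem exists_isSplitting [CompactSpace X] {c : ℝ} (hc : 0 < c)
    (hexp : ∀ x y : X, x ≠ y → ∃ g : G, c < dist (φ g x) (φ g y)) :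
    ∃ (F : Finset G) (Z : Finset X), IsSplitting φ (c / 4) (3 * c / 8) F Z := by
  obtain ⟨Z, -, hZfin, hZ⟩ := finite_cover_balls_of_compact (isCompact_univ (X := X))
    (by positivity : 0 < c / 8)
  have hfar : IsCompact {q : X × X | c / 4 ≤ dist q.1 q.2} :=
    (isClosed_le continuous_const (by fun_prop)).isCompact
  obtain ⟨F, hF⟩ := hfar.elim_finite_subcover
    (fun g : G => {q : X × X | c < dist (φ g q.1) (φ g q.2)})
    (fun g => isOpen_lt continuous_const
      (((φ g).continuous.comp continuous_fst).dist ((φ g).continuous.comp continuous_snd)))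
    (by
      rintro ⟨x, y⟩ hxy
      obtain ⟨g, hg⟩ := hexp x y (dist_pos.mp (lt_of_lt_of_le (by positivity) hxy))
      exact mem_iUnion.mpr ⟨g, hg⟩)
  refine ⟨F, hZfin.toFinset, ?_⟩
  rintro A ⟨hAc, hAconn, x, hx, y, hy, hxy⟩
  obtain ⟨g, hgF, hg⟩ : ∃ g ∈ F, c < dist (φ g x) (φ g y) := by
    simpa using hF (show (x, y) ∈ {q : X × X | c / 4 ≤ dist q.1 q.2} from hxy)
  have hBc : IsCompact (φ g '' A) := hAc.image (φ g).continuous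
  have hBconn : IsConnected (φ g '' A) := hAconn.image _ (φ g).continuous.continuousOn
  have hnet : ∀ w : X, ∃ z ∈ Z, dist w z < c / 8 := by
    intro w
    simpa using hZ (mem_univ w)
  have hpart : ∀ w ∈ φ g '' A, ∀ v ∈ φ g '' A, c < dist w v → ∀ z, dist w z < c / 8 →
      ∃ D ⊆ φ g '' A, D ⊆ closedBall z (3 * c / 8) ∧ IsLargeContinuum (c / 4) D := by
    intro w hw v hv hwv z hwz
    obtain ⟨D, hD, hDw, hDl⟩ := exists_isLargeContinuum_subset_closedBall hBc hBconn hw hv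
      (by positivity : 0 < c / 4) (by linarith)
    exact ⟨D, hD, hDw.trans (closedBall_subset_closedBall' (by linarith)), hDl⟩
  obtain ⟨z, hz, hxz⟩ := hnet (φ g x)
  obtain ⟨z', hz', hyz'⟩ := hnet (φ g y)
  refine ⟨g, hgF, z, by simpa using hz, z', by simpa using hz', ?_,
    hpart _ (mem_image_of_mem _ hx) _ (mem_image_of_mem _ hy) hg z hxz,
    hpart _ (mem_image_of_mem _ hy) _ (mem_image_of_mem _ hx) (by rwa [dist_comm]) z' hyz'⟩
  have h1 := dist_triangle4 (φ g x) z z' (φ g y)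
  rw [dist_comm z' (φ g y)] at h1
  linarith

end Coding

theorem theorem1p2 (G : Type*) [Group G] [Group.FG G] (hG : HasSubexponentialGrowth G)
    (X : Type*) [MetricSpace X] [CompactSpace X] [ConnectedSpace X] [Nontrivial X]
    (hX : IsSuslinian X) (φ : G →* (X ≃ₜ X)) :
    ¬ IsExpansiveAction φ := by
  classical
  rintro ⟨c, hc, hsup⟩
  have hexp : ∀ x y : X, x ≠ y → ∃ g : G, c < dist (φ g x) (φ g y) := fun x y hxy =>
    exists_lt_of_lt_ciSup (hsup x y hxy)
  obtain ⟨F, Z, hsplit⟩ := exists_isSplitting hc hexp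
  have huniv : IsLargeContinuum (c / 4) (univ : Set X) := by
    obtain ⟨x, y, hxy⟩ := exists_pair_ne X
    obtain ⟨g, hg⟩ := hexp x y hxy
    exact ⟨isCompact_univ, isConnected_univ, φ g x, mem_univ _, φ g y, mem_univ _, by linarith⟩
  obtain ⟨e, he, hD⟩ := hsplit.exists_coding
    (summable_card_pow_of_hasSubexponentialGrowth hG F) huniv
  choose D hDsub hDl using hD
  have hdisj : ∀ σ τ, σ ≠ τ → Disjoint (D σ) (D τ) := fun σ τ h =>
    (disjoint_iInter_cylinder (φ := φ) (fun i => (he i).2.2.2.2) h).mono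
      (subset_iInter (hDsub σ)) (subset_iInter (hDsub τ))
  have hinj : Function.Injective D := by
    intro σ τ h
    by_contra hne
    have h1 := hdisj σ τ hne
    rw [h, disjoint_self] at h1
    exact (hDl τ).2.1.nonempty.ne_empty h1
  have hcount : (range D).Countable := by
    refine hX _ ?_ ?_
    · rintro _ ⟨σ, rfl⟩
      obtain ⟨h1, h2, x, hx, y, hy, hxy⟩ := hDl σ
      exact ⟨h1, h2, x, hx, y, hy, dist_pos.mp (lt_of_lt_of_le (by positivity) hxy)⟩
    · rintro _ ⟨σ, rfl⟩ _ ⟨τ, rfl⟩ hne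
      exact hdisj σ τ fun h => hne (congrArg D h)
  have : Countable (range D) := hcount
  have : Countable (ℕ → Bool) := (Equiv.ofInjective D hinj).countable_iff.mpr this
  obtain ⟨f, hf⟩ := exists_surjective_nat (ℕ → Bool)
  -- Cantor's diagonal sequence is not in the range of `f`.
  obtain ⟨n, hn⟩ := hf fun n => !(f n n)
  simpa using congrFun hn n
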